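/- Let $\Theta$ be a variety of (nonempty) algebras defined by identities in an arbitrary signature of operations and constants, let $X^0$ be an infinite set of variables, and for a set $Z$ of variables let $W(Z)$ be the free algebra of $\Theta$ over $Z$. For $H\in\Theta$ and a finite $X\subset X^0$, points are the homomorphisms $\mu:W(X)\to H$. *LG-definable sets.* The multi-sorted pure formulas are generated, over all finite sorts $X\subset X^0$, by the equalities $w\equiv w'$ ($w,w'\in W(X)$), the Boolean operations, the quantifiers $\exists x$ ($x\in X$) and the operations $s_*$ from sort $Y$ to sort $X$, one for each homomorphism $s:W(Y)\to W(X)$. Their values $Val^X_H(u)\subset Hom(W(X),H)$ are computed by the rules: $\mu\in Val^X_H(w\equiv w')$ iff $\mu(w)=\mu(w')$; Boolean operations are set-theoretic; $\mu\in Val^X_H(\exists x\,u)$ iff some $\nu\in Val^X_H(u)$ agrees with $\mu$ on $X\setminus\{x\}$; $\mu\in Val^X_H(s_*u)$ iff $\mu s\in Val^Y_H(u)$. The algebra of formulas $\Phi(X)$ consists of the pure formulas of sort $X$, two of them being identified when they have the same value in every $H\in\Theta$. Put $LKer(\mu)=\{u\in\Phi(X):\mu\in Val^X_H(u)\}$.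 A set $A\subset Hom(W(X),H)$ is *LG-definable* if $A=\{\mu: T\subset LKer(\mu)\}$ for some $T\subset\Phi(X)$. Algebras $H_1,H_2\in\Theta$ are *isotypic* if for every finite $X\subset X^0$ the sets $\{LKer(\mu)\mid \mu:W(X)\to H_i\}$, $i=1,2$, coincide. *MT-definable sets.* Let $\Phi(X^0)$ be the algebra of ordinary first-order formulas with variables in $X^0$, modulo equivalence in all algebras of $\Theta$. An element of $\Phi(X^0)$ is $X$-special if it is represented by a formula whose free variables lie in $X$ and whose bound variables lie in $X^0\setminus X$. For $\mu:W(X)\to H$, $Tp^H(\mu)$ is the set of all $X$-special $u$ such that every $\eta:W(X^0)\to H$ with $\eta(x)=\mu(x)$ for all $x\in X$ satisfies $u$. An $X$-type (for $H$) is a set of $X$-special formulas that is consistent with the elementary theory of $H$ (satisfied at a point over some algebra of $\Theta$ that is a model of this theory); the set of all $X$-special formulas is also admitted, as the improper $X$-type. A set $A\subset Hom(W(X),H)$ is *MT-definable* if $A=\{\mu:T\subset Tp^H(\mu)\}$ for some $X$-type $T$. *Categories.* The objects of $Set_\Theta(H)$ are the pairs $(X,A)$ with $X\subset X^0$ finite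 and $A\subset Hom(W(X),H)$; the morphisms $[s]:(X,A)\to(Y,B)$ are the maps $A\to B$ of the form $\mu\mapsto\mu s$ with $s:W(Y)\to W(X)$ a homomorphism. $LK_\Theta(H)$ and $L_0K_\Theta(H)$ are the full subcategories of the $(X,A)$ with $A$ LG-definable, respectively MT-definable. **Corollary 3.15.** For every $H\in\Theta$ the categories $LK_\Theta(H)$ and $L_0K_\Theta(H)$ coincide, that is, they are full subcategories of $Set_\Theta(H)$ with the same objects. Consequently, if $H_1,H_2\in\Theta$ are isotypic, then the categories $L_0K_\Theta(H_1)$ and $L_0K_\Theta(H_2)$ are isomorphic. -/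

import Mathlib

open CategoryTheory
open scoped FirstOrder

universe u v

namespace LogicalGeometry

/-- A variety of algebras in the signature `L`, given by a set of defining identities. -/
abbrev Variety (L : FirstOrder.Language.{u, v}) : Type u := Set (L.Term ℕ × L.Term ℕ)

/-- The algebras of the variety `Θ`: (nonempty) `L`-algebras satisfying all identities of `Θ`. -/
structure Alg {L : FirstOrder.Language.{u, v}} (Θ : Variety L) where
  carrier : Type u
  [str : L.Structure carrier]
  [nonempty : Nonempty carrier]
  holds : ∀ p ∈ Θ, ∀ a : ℕ → carrier, p.1.realize a = p.2.realize a

instance {L : FirstOrder.Language.{u, v}} (Θ : Variety L) : CoeSort (Alg Θ) (Type u) := ⟨Alg.carrier⟩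

instance {L : FirstOrder.Language.{u, v}} {Θ : Variety L} (H : Alg Θ) : L.Structure H := H.str

instance {L : FirstOrder.Language.{u, v}} {Θ : Variety L} (H : Alg Θ) : Nonempty H := H.nonempty

section FreeAlgebra

variable {L : FirstOrder.Language.{u, v}} (Θ : Variety L) (α : Type u)

/-- Two terms in the variables `α` are identified when they agree in all algebras of `Θ`. -/
def termSetoid : Setoid (L.Term α) where
  r t t' := ∀ (H : Alg Θ) (a : α → H), t.realize a = t'.realize a
  iseqv := ⟨fun _ _ _ => rfl, fun h H a => (h H a).symm, fun h h' H a => (h H a).trans (h' H a)⟩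

/-- `W(α)`: the free algebra of the variety `Θ` over the set of variables `α`. -/
def W : Type u := Quotient (termSetoid Θ α)

variable {α}

/-- The element of the free algebra represented by a term. -/
def W.mk (t : L.Term α) : W Θ α := Quotient.mk (termSetoid Θ α) t

/-- The free generator `x` of the free algebra. -/
def W.gen (x : α) : W Θ α := W.mk Θ (.var x)

variable (α)

noncomputable instance W.structure [L.IsAlgebraic] : L.Structure (W Θ α) where
  funMap f w := W.mk Θ (.func f fun i => (w i).out)
  RelMap r _ := isEmptyElim r

variable {α}

theorem W.funMap_mk [L.IsAlgebraic] {n : ℕ} (f : L.Functions n) (ts : Fin n → L.Term α) :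
    FirstOrder.Language.Structure.funMap f (fun i => W.mk Θ (ts i)) = W.mk Θ (.func f ts) := by
  refine Quotient.sound fun H a => ?_
  simp only [FirstOrder.Language.Term.realize]
  congr 1
  funext i
  exact Quotient.mk_out (s := termSetoid Θ α) (ts i) H a

end FreeAlgebra

section MultiSorted

variable {L : FirstOrder.Language.{u, v}} [L.IsAlgebraic] (Θ : Variety L) {V : Type u}

/-- The affine space `Hom(W(X), H)` for a finite set of variables `X`. -/
abbrev Point (X : Finset V) (H : Alg Θ) : Type u := W Θ X →[L] H

/-- The absolutely free multi-sorted algebra of pure formulas over the equalities: the sorts are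
the finite sets `X` of variables; the operations are the Boolean ones, the quantifiers `∃ x` for
`x ∈ X`, and `s_* : (sort Y) → (sort X)` for every homomorphism `s : W(Y) → W(X)`. -/
inductive PureFormula : Finset V → Type u
  | eq {X : Finset V} (w w' : W Θ X) : PureFormula X
  | bot {X : Finset V} : PureFormula X
  | neg {X : Finset V} (p : PureFormula X) : PureFormula X
  | and {X : Finset V} (p q : PureFormula X) : PureFormula X
  | or {X : Finset V} (p q : PureFormula X) : PureFormula X
  | ex {X : Finset V} (x : X) (p : PureFormula X) : PureFormula X
  | star {X Y : Finset V} (s : W Θ Y →[L] W Θ X) (p : PureFormula Y) : PureFormula X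

/-- The value of a pure formula in the Halmos algebra of all subsets of the affine spaces
over `H`. -/
def PureFormula.val (H : Alg Θ) : {X : Finset V} → PureFormula Θ X → Set (Point Θ X H)
  | _, .eq w w' => {μ | μ w = μ w'}
  | _, .bot => ∅
  | _, .neg p => (p.val H)ᶜ
  | _, .and p q => p.val H ∩ q.val H
  | _, .or p q => p.val H ∪ q.val H
  | _, .ex x p => {μ | ∃ ν ∈ p.val H, ∀ x', x' ≠ x → μ (W.gen Θ x') = ν (W.gen Θ x')}
  | _, .star s p => {μ | μ.comp s ∈ p.val H}

/-- The congruence of all identities between pure formulas that hold in the Halmos algebras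
of all `H` in `Θ` (these algebras generate the variety of Halmos algebras). -/
def pureSetoid (X : Finset V) : Setoid (PureFormula Θ X) where
  r p q := ∀ H : Alg Θ, p.val Θ H = q.val Θ H
  iseqv := ⟨fun _ _ => rfl, fun h H => (h H).symm, fun h h' H => (h H).trans (h' H)⟩

/-- The algebra of formulas `Φ(X)`, for a finite set of variables `X`. -/
def Phi (X : Finset V) : Type u := Quotient (pureSetoid Θ X)

/-- `Val_H^X : Φ(X) → Bool(W(X), H)`. -/
def Val (H : Alg Θ) {X : Finset V} (p : Phi Θ X) : Set (Point Θ X H) :=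
  Quotient.lift (PureFormula.val Θ H) (fun p q (h : ∀ K : Alg Θ, p.val Θ K = q.val Θ K) => h H) p

/-- The logical kernel (LG-type) of a point. -/
def LKer {H : Alg Θ} {X : Finset V} (μ : Point Θ X H) : Set (Phi Θ X) := {p | μ ∈ Val Θ H p}

/-- `T^L_H`, the set of points satisfying all formulas in `T`. -/
def elementarySet (H : Alg Θ) {X : Finset V} (T : Set (Phi Θ X)) : Set (Point Θ X H) :=
  {μ | T ⊆ LKer Θ μ}

/-- LG-definable (elementary) sets of points. -/
def LGDefinable (H : Alg Θ) {X : Finset V} (A : Set (Point Θ X H)) : Prop :=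
  ∃ T : Set (Phi Θ X), A = elementarySet Θ H T

/-- `S^X(H)`, the set of LG-types realized by points over `H`. -/
def realizedTypes (H : Alg Θ) (X : Finset V) : Set (Set (Phi Θ X)) :=
  Set.range fun μ : Point Θ X H => LKer Θ μ

variable (V) in
/-- Isotypic algebras: the same LG-types are realized, for every finite set of variables. -/
def Isotypic (H₁ H₂ : Alg Θ) : Prop :=
  ∀ X : Finset V, realizedTypes Θ H₁ X = realizedTypes Θ H₂ X

end MultiSorted

section OneSorted

/-- The variables occurring in a term. -/
def termVars {L : FirstOrder.Language.{u, v}} {α : Type u} : L.Term α → Set α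
  | .var a => {a}
  | .func _ ts => ⋃ i, termVars (ts i)

/-- Pure one-sorted first-order formulas, with named variables from `V`. -/
inductive FOFormula (L : FirstOrder.Language.{u, v}) (V : Type u) : Type u
  | eq (t t' : L.Term V) : FOFormula L V
  | bot : FOFormula L V
  | neg (p : FOFormula L V) : FOFormula L V
  | and (p q : FOFormula L V) : FOFormula L V
  | or (p q : FOFormula L V) : FOFormula L V
  | ex (x : V) (p : FOFormula L V) : FOFormula L V

/-- Free variables. -/
def FOFormula.free {L : FirstOrder.Language.{u, v}} {V : Type u} : FOFormula L V → Set V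
  | .eq t t' => termVars t ∪ termVars t'
  | .bot => ∅
  | .neg p => p.free
  | .and p q => p.free ∪ q.free
  | .or p q => p.free ∪ q.free
  | .ex x p => p.free \ {x}

/-- Bound variables. -/
def FOFormula.bound {L : FirstOrder.Language.{u, v}} {V : Type u} : FOFormula L V → Set V
  | .eq _ _ => ∅
  | .bot => ∅
  | .neg p => p.bound
  | .and p q => p.bound ∪ q.bound
  | .or p q => p.bound ∪ q.bound
  | .ex x p => insert x p.bound

variable {L : FirstOrder.Language.{u, v}} [L.IsAlgebraic] (Θ : Variety L) {V : Type u}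

/-- The points `W(V) → H` satisfying a one-sorted formula. -/
def FOFormula.val (H : Alg Θ) : FOFormula L V → Set (W Θ V →[L] H)
  | .eq t t' => {η | η (W.mk Θ t) = η (W.mk Θ t')}
  | .bot => ∅
  | .neg p => (p.val H)ᶜ
  | .and p q => p.val H ∩ q.val H
  | .or p q => p.val H ∪ q.val H
  | .ex x p => {η | ∃ ξ ∈ p.val H, ∀ x', x' ≠ x → η (W.gen Θ x') = ξ (W.gen Θ x')}

variable (V) in
/-- Logical equivalence of one-sorted formulas over `Θ`. -/
def foSetoid : Setoid (FOFormula L V) where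
  r p q := ∀ H : Alg Θ, p.val Θ H = q.val Θ H
  iseqv := ⟨fun _ _ => rfl, fun h H => (h H).symm, fun h h' H => (h H).trans (h' H)⟩

variable (V) in
/-- The Lindenbaum–Tarski algebra `Φ(X⁰)` of first-order formulas, where `X⁰ = V` is the set of
all variables. -/
def Phi₀ : Type u := Quotient (foSetoid Θ V)

/-- `Val_H` on `Φ(X⁰)`. -/
def Val₀ (H : Alg Θ) (p : Phi₀ Θ V) : Set (W Θ V →[L] H) :=
  Quotient.lift (FOFormula.val Θ H) (fun p q (h : ∀ K : Alg Θ, p.val Θ K = q.val Θ K) => h H) p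

/-- `X`-special elements of `Φ(X⁰)`: those given by a formula all of whose free variables belong
to `X` and none of whose bound variables does. -/
def IsSpecial (X : Finset V) (p : Phi₀ Θ V) : Prop :=
  ∃ φ : FOFormula L V, Quotient.mk (foSetoid Θ V) φ = p ∧
    φ.free ⊆ X ∧ Disjoint φ.bound (X : Set V)

/-- The MT-type `Tp^H(μ)`: the `X`-special formulas `p(x₁, …, xₙ; y₁, …, yₘ)` such that
`p(μ x₁, …, μ xₙ; y₁, …, yₘ)` holds in `H`, whatever the values of the variables outside `X`. -/
def Tp {H : Alg Θ} {X : Finset V} (μ : Point Θ X H) : Set (Phi₀ Θ V) :=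
  {p | IsSpecial Θ X p ∧ ∀ η : W Θ V →[L] H,
    (∀ x : X, η (W.gen Θ x.1) = μ (W.gen Θ x)) → η ∈ Val₀ Θ H p}

variable (V) in
/-- The elementary theory of `H`, as a subset of `Φ(X⁰)`. -/
def theory (H : Alg Θ) : Set (Phi₀ Θ V) := {p | Val₀ Θ H p = Set.univ}

/-- `T` is consistent with the elementary theory of `H`: it is satisfied at a point over some
model of that theory. -/
def ConsistentWithTheory (H : Alg Θ) (T : Set (Phi₀ Θ V)) : Prop :=
  ∃ (K : Alg Θ) (η : W Θ V →[L] K), theory Θ V H ⊆ theory Θ V K ∧ ∀ p ∈ T, η ∈ Val₀ Θ K p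

/-- `X`-types over `H`: sets of `X`-special formulas consistent with the elementary theory of `H`,
together with the improper type of all `X`-special formulas, which is the type
`⋂ μ ∈ A, Tp^H(μ)` (taken inside the `X`-special formulas) assigned to `A = ∅`. -/
def IsMTType (H : Alg Θ) (X : Finset V) (T : Set (Phi₀ Θ V)) : Prop :=
  ((∀ p ∈ T, IsSpecial Θ X p) ∧ ConsistentWithTheory Θ H T) ∨ T = {p | IsSpecial Θ X p}

/-- `T^{L₀}_H`. -/
def typeSet (H : Alg Θ) (X : Finset V) (T : Set (Phi₀ Θ V)) : Set (Point Θ X H) :=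
  {μ | T ⊆ Tp Θ μ}

/-- MT-definable sets of points. -/
def MTDefinable (H : Alg Θ) {X : Finset V} (A : Set (Point Θ X H)) : Prop :=
  ∃ T : Set (Phi₀ Θ V), IsMTType Θ H X T ∧ A = typeSet Θ H X T

end OneSorted

section Categories

variable {L : FirstOrder.Language.{u, v}} [L.IsAlgebraic] (Θ : Variety L) (V : Type u)

/-- The objects `(X, A)` of the category `Set_Θ(H)`. -/
structure SetCat (H : Alg Θ) where
  X : Finset V
  A : Set (Point Θ X H)

/-- The morphisms `[s] : (X, A) → (Y, B)`: the maps `A → B` of the form `μ ↦ μ ∘ s` for some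
homomorphism `s : W(Y) → W(X)`. -/
def SetCat.Mor {Θ : Variety L} {V : Type u} {H : Alg Θ} (P Q : SetCat Θ V H) : Type u :=
  {f : P.A → Q.A // ∃ s : W Θ Q.X →[L] W Θ P.X, ∀ μ : P.A, (f μ).1 = μ.1.comp s}

instance (H : Alg Θ) : Category (SetCat Θ V H) where
  Hom P Q := SetCat.Mor P Q
  id P := ⟨id, FirstOrder.Language.Hom.id L _, fun μ => (FirstOrder.Language.Hom.comp_id μ.1).symm⟩
  comp f g := ⟨g.1 ∘ f.1, by
    obtain ⟨s, hs⟩ := f.2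
    obtain ⟨t, ht⟩ := g.2
    exact ⟨s.comp t, fun μ => by
      rw [Function.comp_apply, ht, hs, FirstOrder.Language.Hom.comp_assoc]⟩⟩

/-- The class of objects `(X, A)` of `Set_Θ(H)` with `A` an LG-definable set. -/
def lgObjects (H : Alg Θ) : ObjectProperty (SetCat Θ V H) := fun P => LGDefinable Θ H P.A

/-- The class of objects `(X, A)` of `Set_Θ(H)` with `A` an MT-definable set. -/
def mtObjects (H : Alg Θ) : ObjectProperty (SetCat Θ V H) := fun P => MTDefinable Θ H P.A

/-- `LK_Θ(H)`: the full subcategory of `Set_Θ(H)` of LG-definable sets. -/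
abbrev LK (H : Alg Θ) := (lgObjects Θ V H).FullSubcategory

/-- `L₀K_Θ(H)`: the full subcategory of `Set_Θ(H)` of MT-definable sets. -/
abbrev L₀K (H : Alg Θ) := (mtObjects Θ V H).FullSubcategory

/-- Isomorphism of categories. -/
def IsomorphicCategories (C D : Type*) [Category C] [Category D] : Prop :=
  ∃ (F : C ⥤ D) (G : D ⥤ C), F ⋙ G = 𝟭 C ∧ G ⋙ F = 𝟭 D

end Categories

end LogicalGeometry

namespace LogicalGeometry

open FirstOrder.Language

/-! ### Free algebras: evaluation and the universal property. -/

section FreeAlgebra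

variable {L : FirstOrder.Language.{u, v}}

/-! Multi-sorted formulas of sort `X` and `X`-special first-order formulas cut out the same sets of
points, uniformly in `H`.

In one direction (`exists_foFormula_of_pureFormula`), the operations `s_*` are absorbed into a
substitution of terms for variables, and each quantifier binds a fresh variable, available because
`V` is infinite, so that bound variables stay outside `X`. In the other (`exists_phi_of_special`), a
formula is read in a sort `Z` containing all its variables, then brought to sort `X` by `s_*`, where
`s : W(Z) → W(X)` fixes the variables in `X` and sends the rest to a chosen element. If `W(X)` is
empty there is at most one point, and every set of points is LG-definable. The empty set is
MT-definable through the improper type; a nonempty set yields a type already satisfied over `H`.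

For isotypic algebras, send `A` to the set of points over the other algebra sharing their `LKer`
with a point of `A`. LG-definable sets are unions of `LKer`-classes, so this is invertible on them;
a morphism keeps its `s`, and `comp_eq_comp_of_LKer` makes the result independent of which `s`
represents it. -/

theorem termVars_finite {α : Type u} (t : L.Term α) : (termVars t).Finite := by
  induction t with
  | var a => exact Set.finite_singleton a
  | func f ts ih => exact Set.finite_iUnion ih

theorem realize_congr_termVars {α : Type u} {M : Type*} [L.Structure M] (t : L.Term α)
    {a b : α → M} (h : ∀ x ∈ termVars t, a x = b x) : t.realize a = t.realize b := by
  induction t with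
  | var x => exact h x rfl
  | func f ts ih =>
    simp only [Term.realize]
    congr 1
    funext i
    exact ih i fun x hx => h x (Set.mem_iUnion.2 ⟨i, hx⟩)

theorem termVars_subst {α β : Type u} (t : L.Term α) (σ : α → L.Term β) {F : Set β}
    (hσ : ∀ y, termVars (σ y) ⊆ F) : termVars (t.subst σ) ⊆ F := by
  induction t with
  | var x => exact hσ x
  | func f ts ih => exact Set.iUnion_subset ih

theorem exists_relabel_eq {α : Type u} (Z : Set α) (t : L.Term α) (h : termVars t ⊆ Z) :
    ∃ t' : L.Term Z, t'.relabel Subtype.val = t := by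
  induction t with
  | var x => exact ⟨.var ⟨x, h rfl⟩, rfl⟩
  | func f ts ih =>
    choose ts' hts' using fun i => ih i ((Set.subset_iUnion _ i).trans h)
    exact ⟨.func f ts', by simp [Term.relabel, hts']⟩

variable {Θ : Variety L}

/-- A term representing an element of the free algebra. -/
noncomputable def W.out {α : Type u} (w : W Θ α) : L.Term α := Quotient.out w

theorem W.mk_out {α : Type u} (w : W Θ α) : W.mk Θ w.out = w := Quotient.out_eq w

variable [L.IsAlgebraic]

theorem W.realize_mk {α : Type*} {β : Type u} (t : L.Term α) (σ : α → L.Term β) :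
    t.realize (fun x => W.mk Θ (σ x)) = W.mk Θ (t.subst σ) := by
  induction t with
  | var x => rfl
  | func f ts ih => simp only [Term.realize, Term.subst, ih, W.funMap_mk]


theorem hom_mk {α : Type u} {M : Type*} [L.Structure M] (μ : W Θ α →[L] M) (t : L.Term α) :
    μ (W.mk Θ t) = t.realize fun x => μ (W.gen Θ x) := by
  induction t with
  | var x => rfl
  | func f ts ih => simp only [← W.funMap_mk, Hom.map_fun, Term.realize, Function.comp_def, ih]

theorem hom_ext {α : Type u} {M : Type*} [L.Structure M] {μ ν : W Θ α →[L] M}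
    (h : ∀ x, μ (W.gen Θ x) = ν (W.gen Θ x)) : μ = ν := by
  ext w
  rw [← W.mk_out w, hom_mk, hom_mk]
  simp only [h]

/-- The universal property of the free algebra. -/
noncomputable def W.lift {α : Type u} {H : Alg Θ} (a : α → H) : W Θ α →[L] H where
  toFun := Quotient.lift (fun t => t.realize a) fun _ _ h => h H a
  map_fun' f w := by
    refine congrArg (Structure.funMap f) (funext fun i => ?_)
    exact congrArg (Quotient.lift (s := termSetoid Θ α) (fun t => t.realize a) fun _ _ h => h H a)
      (W.mk_out (w i))
  map_rel' r _ := isEmptyElim r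

@[simp] theorem W.lift_mk {α : Type u} {H : Alg Θ} (a : α → H) (t : L.Term α) :
    W.lift a (W.mk Θ t) = t.realize a := rfl

@[simp] theorem W.lift_gen {α : Type u} {H : Alg Θ} (a : α → H) (x : α) :
    W.lift a (W.gen Θ x) = a x := rfl

variable (Θ) in
/-- A nonempty free algebra, as an algebra of the variety. -/
noncomputable def W.alg (α : Type u) [Nonempty (W Θ α)] : Alg Θ where
  carrier := W Θ α
  holds p hp a := by
    -- Over representing terms, evaluation is substitution, and an identity of `Θ` survives
    -- substitution.
    have ha : a = fun n => W.mk Θ (a n).out := funext fun n => (W.mk_out _).symm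
    rw [ha, W.realize_mk, W.realize_mk]
    refine Quotient.sound fun H b => ?_
    rw [Term.realize_subst, Term.realize_subst]
    exact H.holds p hp _

end FreeAlgebra

/-! ### Translations between multi-sorted and one-sorted formulas. -/

section Translation

theorem FOFormula.free_finite {L : FirstOrder.Language.{u, v}} {V : Type u}
    (φ : FOFormula L V) : φ.free.Finite := by
  induction φ with
  | eq t t' => exact (termVars_finite t).union (termVars_finite t')
  | bot => exact Set.finite_empty
  | neg p ih => exact ih
  | and p q ihp ihq => exact ihp.union ihq
  | or p q ihp ihq => exact ihp.union ihq
  | ex x p ih => exact ih.sdiff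

theorem FOFormula.bound_finite {L : FirstOrder.Language.{u, v}} {V : Type u}
    (φ : FOFormula L V) : φ.bound.Finite := by
  induction φ with
  | eq t t' => exact Set.finite_empty
  | bot => exact Set.finite_empty
  | neg p ih => exact ih
  | and p q ihp ihq => exact ihp.union ihq
  | or p q ihp ihq => exact ihp.union ihq
  | ex x p ih => exact ih.insert x

variable {L : FirstOrder.Language.{u, v}} [L.IsAlgebraic] {Θ : Variety L} {V : Type u}

theorem hom_mk_congr {α : Type u} {M : Type*} [L.Structure M] {η ξ : W Θ α →[L] M} (t : L.Term α)
    (h : ∀ x ∈ termVars t, η (W.gen Θ x) = ξ (W.gen Θ x)) : η (W.mk Θ t) = ξ (W.mk Θ t) := by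
  rw [hom_mk, hom_mk]
  exact realize_congr_termVars t h

/-- The translation of pure multi-sorted formulas into one-sorted ones, along a substitution of
terms for the variables of the sort. -/
theorem exists_foFormula_of_pureFormula [Infinite V] {Y : Finset V} (p : PureFormula Θ Y) :
    ∀ (F : Finset V) (σ : Y → L.Term V), (∀ y, termVars (σ y) ⊆ F) →
      ∃ φ : FOFormula L V, φ.free ⊆ F ∧ Disjoint φ.bound (F : Set V) ∧
        ∀ (H : Alg Θ) (η : W Θ V →[L] H),
          η ∈ φ.val Θ H ↔ (W.lift fun y => η (W.mk Θ (σ y))) ∈ p.val Θ H := by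
  classical
  induction p with
  | eq w w' =>
    intro F σ hσ
    refine ⟨.eq (Term.subst w.out σ) (Term.subst w'.out σ),
      Set.union_subset (termVars_subst _ _ hσ) (termVars_subst _ _ hσ),
      Set.empty_disjoint _, fun H η => ?_⟩
    have key : ∀ w : W Θ _, η (W.mk Θ (Term.subst w.out σ))
        = (W.lift fun y => η (W.mk Θ (σ y))) w := fun w => by
      conv_rhs => rw [← W.mk_out w]
      rw [W.lift_mk, hom_mk, Term.realize_subst]
      simp only [hom_mk]
    change η _ = η _ ↔ W.lift _ _ = W.lift _ _
    rw [key, key]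
  | bot => exact fun F σ _ => ⟨.bot, Set.empty_subset _, Set.empty_disjoint _, fun H η => Iff.rfl⟩
  | neg p ih =>
    intro F σ hσ
    obtain ⟨φ, hf, hb, hv⟩ := ih F σ hσ
    exact ⟨.neg φ, hf, hb, fun H η => not_congr (hv H η)⟩
  | and p q ihp ihq =>
    intro F σ hσ
    obtain ⟨φ, hf, hb, hv⟩ := ihp F σ hσ
    obtain ⟨ψ, hf', hb', hv'⟩ := ihq F σ hσ
    exact ⟨.and φ ψ, Set.union_subset hf hf', hb.union_left hb',
      fun H η => and_congr (hv H η) (hv' H η)⟩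
  | or p q ihp ihq =>
    intro F σ hσ
    obtain ⟨φ, hf, hb, hv⟩ := ihp F σ hσ
    obtain ⟨ψ, hf', hb', hv'⟩ := ihq F σ hσ
    exact ⟨.or φ ψ, Set.union_subset hf hf', hb.union_left hb',
      fun H η => or_congr (hv H η) (hv' H η)⟩
  | ex x p ih =>
    intro F σ hσ
    -- `F` contains the variables of every `σ y`, so moving the value at `z` disturbs none of them;
    -- `z` takes over the role of `x`.
    obtain ⟨z, hz⟩ := Infinite.exists_notMem_finset F
    obtain ⟨φ, hf, hb, hv⟩ := ih (insert z F) (Function.update σ x (.var z)) (by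
      intro y
      rcases eq_or_ne y x with rfl | hy
      · simp [termVars]
      · rw [Function.update_of_ne hy]
        exact (hσ y).trans (by simp))
    rw [Finset.coe_insert] at hf hb
    refine ⟨.ex z φ, ?_, ?_, fun H η => ?_⟩
    · rintro v ⟨hv, hne⟩
      exact (hf hv).resolve_left hne
    · rw [FOFormula.bound, Set.disjoint_insert_left]
      exact ⟨by simpa using hz, hb.mono_right (Set.subset_insert _ _)⟩
    · have hF : ∀ ξ : W Θ V →[L] H, (∀ x', x' ≠ z → η (W.gen Θ x') = ξ (W.gen Θ x')) →
          ∀ y, η (W.mk Θ (σ y)) = ξ (W.mk Θ (σ y)) := fun ξ h y =>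
        hom_mk_congr _ fun v hvσ => h v (by rintro rfl; exact hz (hσ y hvσ))
      constructor
      · rintro ⟨ξ, hξ, h⟩
        refine ⟨_, (hv H ξ).1 hξ, fun y hy => ?_⟩
        simp only [W.lift_gen, Function.update_of_ne hy]
        exact hF ξ h y
      · rintro ⟨ν, hν, h⟩
        have hξ : ∀ x', x' ≠ z → η (W.gen Θ x') =
            W.lift (Function.update (fun v => η (W.gen Θ v)) z (ν (W.gen Θ x))) (W.gen Θ x') :=
          fun x' hx' => by rw [W.lift_gen, Function.update_of_ne hx']
        refine ⟨_, (hv H _).2 ?_, hξ⟩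
        convert hν using 1
        refine hom_ext fun y => ?_
        rcases eq_or_ne y x with rfl | hy
        · simp
        · rw [W.lift_gen, Function.update_of_ne hy, ← hF _ hξ, ← h y hy, W.lift_gen]
  | star s p ih =>
    -- No syntax is needed for `s_*`: the substitution is precomposed with `s`.
    intro F σ hσ
    obtain ⟨φ, hf, hb, hv⟩ := ih F (fun y => Term.subst ((s (W.gen Θ y)).out) σ)
      fun y => termVars_subst _ _ hσ
    refine ⟨φ, hf, hb, fun H η => (hv H η).trans ?_⟩
    change _ ↔ (W.lift fun y => η (W.mk Θ (σ y))).comp s ∈ p.val Θ H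
    convert Iff.rfl using 2
    refine hom_ext fun y => ?_
    rw [Hom.comp_apply]
    conv_lhs => rw [← W.mk_out (s (W.gen Θ y))]
    rw [W.lift_mk, W.lift_gen, hom_mk, Term.realize_subst]
    simp only [hom_mk]

theorem FOFormula.mem_val_of_eqOn_free {H : Alg Θ} (φ : FOFormula L V) {η ξ : W Θ V →[L] H}
    (h : ∀ x ∈ φ.free, η (W.gen Θ x) = ξ (W.gen Θ x)) : η ∈ φ.val Θ H ↔ ξ ∈ φ.val Θ H := by
  classical
  induction φ generalizing η ξ with
  | eq t t' =>
    change η _ = η _ ↔ ξ _ = ξ _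
    rw [hom_mk_congr t fun x hx => h x (Or.inl hx), hom_mk_congr t' fun x hx => h x (Or.inr hx)]
  | bot => exact Iff.rfl
  | neg p ih => exact not_congr (ih h)
  | and p q ihp ihq =>
    exact and_congr (ihp fun x hx => h x (Or.inl hx)) (ihq fun x hx => h x (Or.inr hx))
  | or p q ihp ihq =>
    exact or_congr (ihp fun x hx => h x (Or.inl hx)) (ihq fun x hx => h x (Or.inr hx))
  | ex x p ih =>
    have key : ∀ {η ξ : W Θ V →[L] H},
        (∀ y ∈ p.free \ {x}, η (W.gen Θ y) = ξ (W.gen Θ y)) →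
        η ∈ (FOFormula.ex x p).val Θ H → ξ ∈ (FOFormula.ex x p).val Θ H := by
      rintro η ξ h ⟨ζ, hζ, hη⟩
      refine ⟨W.lift (Function.update (fun v => ξ (W.gen Θ v)) x (ζ (W.gen Θ x))),
        (ih fun y hy => ?_).1 hζ, fun y hy => ?_⟩
      · rcases eq_or_ne y x with rfl | hyx
        · simp
        · rw [W.lift_gen, Function.update_of_ne hyx, ← hη y hyx, h y ⟨hy, hyx⟩]
      · rw [W.lift_gen, Function.update_of_ne hy]
    exact ⟨key h, key fun y hy => (h y hy).symm⟩

/-- The translation of one-sorted formulas into pure multi-sorted ones, in a sort containing all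
their variables. -/
theorem exists_pureFormula_of_foFormula (Z : Finset V) (φ : FOFormula L V) (hf : φ.free ⊆ Z)
    (hb : φ.bound ⊆ Z) : ∃ p : PureFormula Θ Z, ∀ (H : Alg Θ) (η : W Θ V →[L] H),
      η ∈ φ.val Θ H ↔ (W.lift fun z : Z => η (W.gen Θ z.1)) ∈ p.val Θ H := by
  classical
  induction φ with
  | eq t t' =>
    obtain ⟨r, rfl⟩ := exists_relabel_eq _ t (Set.subset_union_left.trans hf)
    obtain ⟨r', rfl⟩ := exists_relabel_eq _ t' (Set.subset_union_right.trans hf)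
    refine ⟨.eq (W.mk Θ r) (W.mk Θ r'), fun H η => ?_⟩
    change η _ = η _ ↔ W.lift _ _ = W.lift _ _
    rw [hom_mk, hom_mk, Term.realize_relabel, Term.realize_relabel]
    rfl
  | bot => exact ⟨.bot, fun H η => Iff.rfl⟩
  | neg p ih =>
    obtain ⟨q, hq⟩ := ih hf hb
    exact ⟨.neg q, fun H η => not_congr (hq H η)⟩
  | and p q ihp ihq =>
    obtain ⟨p', hp⟩ := ihp (Set.subset_union_left.trans hf) (Set.subset_union_left.trans hb)
    obtain ⟨q', hq⟩ := ihq (Set.subset_union_right.trans hf) (Set.subset_union_right.trans hb)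
    exact ⟨.and p' q', fun H η => and_congr (hp H η) (hq H η)⟩
  | or p q ihp ihq =>
    obtain ⟨p', hp⟩ := ihp (Set.subset_union_left.trans hf) (Set.subset_union_left.trans hb)
    obtain ⟨q', hq⟩ := ihq (Set.subset_union_right.trans hf) (Set.subset_union_right.trans hb)
    exact ⟨.or p' q', fun H η => or_congr (hp H η) (hq H η)⟩
  | ex x p ih =>
    have hx : x ∈ Z := hb (Set.mem_insert _ _)
    -- The sort remains `Z` throughout, since it already contains the bound variables.
    obtain ⟨q, hq⟩ := ih (fun y hy => by
      rcases eq_or_ne y x with rfl | hyx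
      · exact hx
      · exact hf ⟨hy, hyx⟩) ((Set.subset_insert _ _).trans hb)
    refine ⟨.ex ⟨x, hx⟩ q, fun H η => ⟨?_, ?_⟩⟩
    · rintro ⟨ξ, hξ, h⟩
      exact ⟨_, (hq H ξ).1 hξ, fun z hz => h z.1 fun e => hz (Subtype.ext e)⟩
    · rintro ⟨ν, hν, h⟩
      refine ⟨W.lift (Function.update (fun v => η (W.gen Θ v)) x (ν (W.gen Θ ⟨x, hx⟩))),
        (hq H _).2 ?_, fun y hy => by rw [W.lift_gen, Function.update_of_ne hy]⟩
      convert hν using 1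
      refine hom_ext fun z => ?_
      by_cases hz : z = ⟨x, hx⟩
      · subst hz
        simp
      · rw [W.lift_gen, W.lift_gen, Function.update_of_ne fun e => hz (Subtype.ext e), ← h z hz,
          W.lift_gen]

/-- Every point extends to a point on all variables. -/
theorem exists_extension {H : Alg Θ} {X : Finset V} (μ : Point Θ X H) :
    ∃ η : W Θ V →[L] H, ∀ x : X, η (W.gen Θ x.1) = μ (W.gen Θ x) := by
  classical
  refine ⟨W.lift fun v => if h : v ∈ X then μ (W.gen Θ ⟨v, h⟩) else Classical.arbitrary H,
    fun x => ?_⟩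
  rw [W.lift_gen, dif_pos x.2]

/-- The element of `Φ(X)` represented by a pure formula. -/
def Phi.mk {X : Finset V} (p : PureFormula Θ X) : Phi Θ X := Quotient.mk _ p

theorem Phi.mk_surjective {X : Finset V} (u : Phi Θ X) : ∃ p, Phi.mk p = u := Quotient.exists_rep u

variable (Θ) in
/-- The element of `Φ(X⁰)` represented by a one-sorted formula. -/
def Phi₀.mk (φ : FOFormula L V) : Phi₀ Θ V := Quotient.mk _ φ

/-- Truth depends only on the free variables, all in `X`, so a single extension of `μ` decides for
all of them. -/
theorem mem_Tp_iff {H : Alg Θ} {X : Finset V} {μ : Point Θ X H} {φ : FOFormula L V}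
    (hf : φ.free ⊆ X) (hb : Disjoint φ.bound (X : Set V)) {η : W Θ V →[L] H}
    (hη : ∀ x : X, η (W.gen Θ x.1) = μ (W.gen Θ x)) :
    Phi₀.mk Θ φ ∈ Tp Θ μ ↔ η ∈ φ.val Θ H := by
  refine ⟨fun h => h.2 η hη, fun h => ⟨⟨φ, rfl, hf, hb⟩, fun ξ hξ => ?_⟩⟩
  refine (φ.mem_val_of_eqOn_free fun x hx => ?_).1 h
  rw [hη ⟨x, hf hx⟩, hξ ⟨x, hf hx⟩]

theorem exists_special_of_phi [Infinite V] {X : Finset V} (p : Phi Θ X) :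
    ∃ t : Phi₀ Θ V, IsSpecial Θ X t ∧ ∀ (H : Alg Θ) (μ : Point Θ X H),
      t ∈ Tp Θ μ ↔ μ ∈ Val Θ H p := by
  obtain ⟨p, rfl⟩ := p.mk_surjective
  obtain ⟨φ, hf, hb, hv⟩ := exists_foFormula_of_pureFormula p X (fun x => .var x.1) fun y => by
    simp [termVars]
  refine ⟨Phi₀.mk Θ φ, ⟨φ, rfl, hf, hb⟩, fun H μ => ?_⟩
  obtain ⟨η, hη⟩ := exists_extension μ
  rw [mem_Tp_iff hf hb hη, hv H η]
  change _ ↔ μ ∈ p.val Θ H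
  convert Iff.rfl using 2
  exact hom_ext fun x => (hη x).symm

theorem exists_phi_of_special {X : Finset V} (w : W Θ X) {t : Phi₀ Θ V} (ht : IsSpecial Θ X t) :
    ∃ p : Phi Θ X, ∀ (H : Alg Θ) (μ : Point Θ X H), μ ∈ Val Θ H p ↔ t ∈ Tp Θ μ := by
  classical
  obtain ⟨φ, rfl, hf, hb⟩ := ht
  obtain ⟨p, hp⟩ := exists_pureFormula_of_foFormula (Θ := Θ)
    (φ.free_finite.toFinset ∪ φ.bound_finite.toFinset) φ (by simp) (by simp)
  have : Nonempty (W Θ X) := ⟨w⟩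
  -- The default `w` for variables outside `X` is harmless: `v ↦ μ (b v)` is one of the extensions
  -- of `μ`.
  let b : V → W.alg Θ X := fun v => if h : v ∈ X then W.gen Θ ⟨v, h⟩ else w
  let s : W Θ (φ.free_finite.toFinset ∪ φ.bound_finite.toFinset : Finset V) →[L] W Θ X :=
    W.lift (H := W.alg Θ X) fun z => b z.1
  refine ⟨Phi.mk (.star s p), fun H μ => ?_⟩
  have hη : ∀ x : X, W.lift (fun v => μ (b v)) (W.gen Θ x.1) = μ (W.gen Θ x) := fun x => by
    rw [W.lift_gen]
    exact congrArg μ (dif_pos x.2)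
  change _ ↔ Phi₀.mk Θ φ ∈ Tp Θ μ
  rw [mem_Tp_iff hf hb hη, hp]
  change μ.comp s ∈ p.val Θ H ↔ _
  convert Iff.rfl using 2
  exact hom_ext fun z => rfl

end Translation

/-! ### LG-definable and MT-definable sets coincide. -/

section Definable

variable {L : FirstOrder.Language.{u, v}} [L.IsAlgebraic] {Θ : Variety L} {V : Type u}

theorem LGDefinable.mtDefinable [Infinite V] {H : Alg Θ} {X : Finset V} {A : Set (Point Θ X H)}
    (hA : LGDefinable Θ H A) : MTDefinable Θ H A := by
  obtain ⟨T, rfl⟩ := hA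
  rcases (elementarySet Θ H T).eq_empty_or_nonempty with h | ⟨μ₀, hμ₀⟩
  -- The improper type contains `⊥`, so no point satisfies it.
  · refine ⟨{t | IsSpecial Θ X t}, Or.inr rfl, ?_⟩
    rw [h, eq_comm, Set.eq_empty_iff_forall_notMem]
    intro μ hμ
    obtain ⟨η, hη⟩ := exists_extension μ
    exact (hμ (show IsSpecial Θ X (Phi₀.mk Θ .bot) from
      ⟨.bot, rfl, Set.empty_subset _, Set.empty_disjoint _⟩)).2 η hη
  · have key : elementarySet Θ H T = typeSet Θ H X {t | IsSpecial Θ X t ∧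
        ∃ u ∈ T, ∀ μ : Point Θ X H, t ∈ Tp Θ μ ↔ μ ∈ Val Θ H u} := by
      ext μ
      constructor
      · rintro hμ t ⟨-, u, hu, htu⟩
        exact (htu μ).2 (hμ hu)
      · intro hμ u hu
        obtain ⟨t, ht, htu⟩ := exists_special_of_phi u
        exact (htu H μ).1 (hμ ⟨ht, u, hu, htu H⟩)
    refine ⟨_, Or.inl ⟨fun t ht => ht.1, ?_⟩, key⟩
    obtain ⟨η, hη⟩ := exists_extension μ₀
    rw [key] at hμ₀
    -- Consistency is witnessed in `H` itself, at an extension of `μ₀`.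
    exact ⟨H, η, subset_rfl, fun t ht => (hμ₀ ht).2 η hη⟩

theorem IsMTType.isSpecial {H : Alg Θ} {X : Finset V} {T : Set (Phi₀ Θ V)}
    (hT : IsMTType Θ H X T) {t : Phi₀ Θ V} (ht : t ∈ T) : IsSpecial Θ X t := by
  rcases hT with hT | rfl
  · exact hT.1 t ht
  · exact ht

theorem MTDefinable.lgDefinable {H : Alg Θ} {X : Finset V} {A : Set (Point Θ X H)}
    (hA : MTDefinable Θ H A) : LGDefinable Θ H A := by
  -- `exists_phi_of_special` needs an element of `W Θ X`; without one, only `∅` and the whole space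
  -- have to be defined.
  rcases isEmpty_or_nonempty (W Θ X) with hW | ⟨⟨w⟩⟩
  · have : Subsingleton (Point Θ X H) := ⟨fun μ ν => by ext w; exact isEmptyElim w⟩
    rcases Set.eq_empty_or_nonempty A with rfl | hne
    · exact ⟨{Phi.mk .bot}, (Set.eq_empty_iff_forall_notMem.2 fun μ hμ =>
        have h : μ ∈ (PureFormula.bot : PureFormula Θ X).val Θ H :=
          (show {Phi.mk .bot} ⊆ LKer Θ μ from hμ) rfl
        by simp only [PureFormula.val, Set.mem_empty_iff_false] at h).symm⟩
    · refine ⟨∅, ?_⟩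
      rw [Subsingleton.eq_univ_of_nonempty hne]
      exact (Set.eq_univ_of_forall fun μ => Set.empty_subset _).symm
  · obtain ⟨T, hT, rfl⟩ := hA
    refine ⟨{u | ∃ t ∈ T, ∀ μ : Point Θ X H, μ ∈ Val Θ H u ↔ t ∈ Tp Θ μ}, ?_⟩
    ext μ
    constructor
    · rintro hμ u ⟨t, ht, htu⟩
      exact (htu μ).2 (hμ ht)
    · intro hμ t ht
      obtain ⟨u, hu⟩ := exists_phi_of_special w (hT.isSpecial ht)
      exact (hu H μ).1 (hμ ⟨t, ht, hu H⟩)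

theorem lgObjects_eq_mtObjects [Infinite V] (H : Alg Θ) :
    lgObjects Θ V H = mtObjects Θ V H := by
  ext P
  exact ⟨LGDefinable.mtDefinable, MTDefinable.lgDefinable⟩

end Definable

/-! ### Isotypic algebras and transfer of definable sets. -/

section Isotypic

variable {L : FirstOrder.Language.{u, v}} [L.IsAlgebraic] {Θ : Variety L} {V : Type u}

/-- `u` lies in the kernel of `μ ∘ s` exactly when `s_* u` lies in that of `μ`. -/
theorem LKer_comp {H₁ H₂ : Alg Θ} {X Y : Finset V} {μ : Point Θ X H₁} {ν : Point Θ X H₂}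
    (h : LKer Θ μ = LKer Θ ν) (s : W Θ Y →[L] W Θ X) :
    LKer Θ (μ.comp s) = LKer Θ (ν.comp s) := by
  ext p
  obtain ⟨p, rfl⟩ := p.mk_surjective
  exact Set.ext_iff.1 h (Phi.mk (.star s p))

/-- On generators, `μ ∘ s = μ ∘ t` amounts to the equalities `s y ≡ t y` belonging to `LKer μ`. -/
theorem comp_eq_comp_of_LKer {H₁ H₂ : Alg Θ} {X Y : Finset V} {μ : Point Θ X H₁}
    {ν : Point Θ X H₂} (h : LKer Θ μ = LKer Θ ν) {s t : W Θ Y →[L] W Θ X}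
    (hst : μ.comp s = μ.comp t) : ν.comp s = ν.comp t :=
  hom_ext fun y => (Set.ext_iff.1 h (Phi.mk (.eq (s (W.gen Θ y)) (t (W.gen Θ y))))).1
    (DFunLike.congr_fun hst (W.gen Θ y))

theorem LGDefinable.mem_of_LKer_eq {H : Alg Θ} {X : Finset V} {A : Set (Point Θ X H)}
    (hA : LGDefinable Θ H A) {μ ν : Point Θ X H} (h : LKer Θ μ = LKer Θ ν) (hμ : μ ∈ A) :
    ν ∈ A := by
  obtain ⟨T, rfl⟩ := hA
  exact (show T ⊆ LKer Θ μ from hμ).trans h.subset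

theorem Isotypic.symm {H₁ H₂ : Alg Θ} (h : Isotypic Θ V H₁ H₂) : Isotypic Θ V H₂ H₁ :=
  fun X => (h X).symm

theorem Isotypic.exists_LKer_eq {H₁ H₂ : Alg Θ} (h : Isotypic Θ V H₁ H₂) {X : Finset V}
    (ν : Point Θ X H₂) : ∃ μ : Point Θ X H₁, LKer Θ μ = LKer Θ ν :=
  (h X).symm.subset ⟨ν, rfl⟩

/-- The points over `H₂` having the same type as some point of `A`. -/
def transfer {H₁ : Alg Θ} (H₂ : Alg Θ) {X : Finset V} (A : Set (Point Θ X H₁)) :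
    Set (Point Θ X H₂) :=
  {ν | ∃ μ ∈ A, LKer Θ μ = LKer Θ ν}

/-- The same `T` defines the transferred set; isotypy supplies, for each of its solutions over `H₂`,
a point over `H₁` of the same type. -/
theorem LGDefinable.transfer {H₁ H₂ : Alg Θ} (h : Isotypic Θ V H₁ H₂) {X : Finset V}
    {A : Set (Point Θ X H₁)} (hA : LGDefinable Θ H₁ A) :
    LGDefinable Θ H₂ (transfer H₂ A) := by
  obtain ⟨T, rfl⟩ := hA
  refine ⟨T, Set.ext fun ν => ⟨?_, fun hν => ?_⟩⟩
  · rintro ⟨μ, hμ, hμν⟩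
    exact (show T ⊆ LKer Θ μ from hμ).trans hμν.subset
  · obtain ⟨μ, hμν⟩ := h.exists_LKer_eq ν
    exact ⟨μ, (show T ⊆ LKer Θ ν from hν).trans hμν.symm.subset, hμν⟩

theorem LGDefinable.transfer_transfer {H₁ H₂ : Alg Θ} (h : Isotypic Θ V H₁ H₂) {X : Finset V}
    {A : Set (Point Θ X H₁)} (hA : LGDefinable Θ H₁ A) :
    LogicalGeometry.transfer H₁ (LogicalGeometry.transfer H₂ A) = A := by
  ext μ
  constructor
  · rintro ⟨ν, ⟨μ', hμ', h'⟩, h''⟩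
    exact hA.mem_of_LKer_eq (h'.trans h'') hμ'
  · intro hμ
    obtain ⟨ν, hν⟩ := h.symm.exists_LKer_eq μ
    exact ⟨ν, ⟨μ, hμ, hν.symm⟩, hν⟩

/-- The morphism of transferred objects given by the same homomorphism of free algebras. -/
noncomputable def SetCat.Mor.transfer {H₁ : Alg Θ} (H₂ : Alg Θ) {P Q : SetCat Θ V H₁}
    (f : SetCat.Mor P Q) : SetCat.Mor (⟨P.X, LogicalGeometry.transfer H₂ P.A⟩ : SetCat Θ V H₂)
      ⟨Q.X, LogicalGeometry.transfer H₂ Q.A⟩ :=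
  ⟨fun ν => ⟨ν.1.comp f.2.choose, by
    obtain ⟨μ, hμ, h⟩ := ν.2
    exact ⟨_, (f.1 ⟨μ, hμ⟩).2, by rw [f.2.choose_spec ⟨μ, hμ⟩]; exact LKer_comp h _⟩⟩,
    f.2.choose, fun _ => rfl⟩

/-- The chosen homomorphism may be replaced by any representative of `f`, which is what makes the
transfer functorial. -/
theorem SetCat.Mor.transfer_apply {H₁ H₂ : Alg Θ} {P Q : SetCat Θ V H₁} (f : SetCat.Mor P Q)
    {s : W Θ Q.X →[L] W Θ P.X} (hs : ∀ μ : P.A, (f.1 μ).1 = μ.1.comp s)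
    (ν : LogicalGeometry.transfer H₂ P.A) : ((f.transfer H₂).1 ν).1 = ν.1.comp s := by
  obtain ⟨μ, hμ, h⟩ := ν.2
  exact comp_eq_comp_of_LKer h ((f.2.choose_spec ⟨μ, hμ⟩).symm.trans (hs ⟨μ, hμ⟩))

/-- The functor induced on LG-definable sets by an isotypic pair of algebras. -/
noncomputable def transferFunctor {H₁ H₂ : Alg Θ} (h : Isotypic Θ V H₁ H₂) :
    LK Θ V H₁ ⥤ LK Θ V H₂ where
  obj P := ⟨⟨P.obj.X, transfer H₂ P.obj.A⟩, P.property.transfer h⟩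
  map f := ObjectProperty.homMk (SetCat.Mor.transfer H₂ f.hom)
  map_id P := by
    ext1
    refine Subtype.ext (funext fun ν => Subtype.ext ?_)
    exact SetCat.Mor.transfer_apply (𝟙 P.obj : P.obj ⟶ P.obj) (s := Hom.id L _) (fun μ => rfl) ν
  map_comp {P Q R} f g := by
    obtain ⟨s, hs⟩ := f.hom.2
    obtain ⟨t, ht⟩ := g.hom.2
    ext1
    refine Subtype.ext (funext fun ν => Subtype.ext ?_)
    refine (SetCat.Mor.transfer_apply (f.hom ≫ g.hom) (s := s.comp t) (fun μ => ?_) ν).trans ?_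
    · exact (ht _).trans (by rw [hs]; rfl)
    · refine Eq.trans ?_ (SetCat.Mor.transfer_apply g.hom ht _).symm
      change _ = Hom.comp ((SetCat.Mor.transfer H₂ f.hom).1 ν).1 t
      rw [SetCat.Mor.transfer_apply f.hom hs]
      rfl

/-- A double transfer returns each object only up to propositional equality, so morphisms are
compared heterogeneously, through their values on points. -/
theorem LK.hom_heq {H : Alg Θ} {X Y : Finset V} {A A' : Set (Point Θ X H)}
    {B B' : Set (Point Θ Y H)} (hA : LGDefinable Θ H A) (hA' : LGDefinable Θ H A')
    (hB : LGDefinable Θ H B) (hB' : LGDefinable Θ H B') (eA : A = A') (eB : B = B')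
    (f : (⟨⟨X, A⟩, hA⟩ : LK Θ V H) ⟶ ⟨⟨Y, B⟩, hB⟩)
    (f' : (⟨⟨X, A'⟩, hA'⟩ : LK Θ V H) ⟶ ⟨⟨Y, B'⟩, hB'⟩)
    (h : ∀ μ (hμ : μ ∈ A) (hμ' : μ ∈ A'), (f.hom.1 ⟨μ, hμ⟩).1 = (f'.hom.1 ⟨μ, hμ'⟩).1) :
    HEq f f' := by
  subst eA eB
  refine heq_of_eq ?_
  ext1
  exact Subtype.ext (funext fun μ => Subtype.ext (h μ.1 μ.2 μ.2))

theorem transferFunctor_comp {H₁ H₂ : Alg Θ} (h : Isotypic Θ V H₁ H₂) :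
    transferFunctor h ⋙ transferFunctor h.symm = 𝟭 (LK Θ V H₁) := by
  refine Functor.hext (fun P => ?_) fun P Q f => ?_
  · obtain ⟨⟨X, A⟩, hA⟩ := P
    have e := LGDefinable.transfer_transfer h hA
    change (⟨⟨X, transfer H₁ (transfer H₂ A)⟩, _⟩ : LK Θ V H₁) = ⟨⟨X, A⟩, hA⟩
    congr
  · obtain ⟨s, hs⟩ := f.hom.2
    refine LK.hom_heq _ P.property _ Q.property (LGDefinable.transfer_transfer h P.property)
      (LGDefinable.transfer_transfer h Q.property) _ _ fun μ hμ hμ' => ?_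
    exact (SetCat.Mor.transfer_apply (SetCat.Mor.transfer H₂ f.hom)
      (fun ν => SetCat.Mor.transfer_apply f.hom hs ν) ⟨μ, hμ⟩).trans (hs ⟨μ, hμ'⟩).symm

theorem Isotypic.isomorphicCategories_LK {H₁ H₂ : Alg Θ} (h : Isotypic Θ V H₁ H₂) :
    IsomorphicCategories (LK Θ V H₁) (LK Θ V H₂) :=
  ⟨transferFunctor h, transferFunctor h.symm, transferFunctor_comp h, transferFunctor_comp h.symm⟩

end Isotypic

end LogicalGeometry

theorem corollary3p15 {L : FirstOrder.Language.{u, v}} [L.IsAlgebraic]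
    (Θ : LogicalGeometry.Variety L) (V : Type u) [Infinite V] :
    (∀ H : LogicalGeometry.Alg Θ,
      LogicalGeometry.lgObjects Θ V H = LogicalGeometry.mtObjects Θ V H) ∧
    (∀ H₁ H₂ : LogicalGeometry.Alg Θ, LogicalGeometry.Isotypic Θ V H₁ H₂ →
      LogicalGeometry.IsomorphicCategories
        (LogicalGeometry.L₀K Θ V H₁) (LogicalGeometry.L₀K Θ V H₂)) := by
  refine ⟨LogicalGeometry.lgObjects_eq_mtObjects, fun H₁ H₂ h => ?_⟩
  unfold LogicalGeometry.L₀K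
  rw [← LogicalGeometry.lgObjects_eq_mtObjects, ← LogicalGeometry.lgObjects_eq_mtObjects]
  exact h.isomorphicCategories_LK
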